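/- Let $l \ge 2$. Let $X_l$ be the collection of symbols $(A_1,\dots,A_l,H)$, where $H$ is a complex Hilbert space and $A_1,\dots,A_l$ are pairwise commuting self-adjoint trace-class operators on $H$, with the addition $$(A_1,\dots,A_l,H_1)+(B_1,\dots,B_l,H_2)=(A_1\oplus B_1,\dots,A_l\oplus B_l,\;H_1\oplus H_2),$$ whose neutral element is the symbol $(0,\dots,0,\mathbb{C}^0)$. For a fixed $H$, the fibre $(X_l)_H$ is the set of all symbols with underlying Hilbert space $H$, with the topology given by the trace norm $\|A\|_1=\mathrm{Tr}\,|A|$ in each of the $l$ components. A trace map on $X_l$ is a map $\psi: X_l\to\mathbb{R}$ with $\psi(0,\dots,0,\mathbb{C}^0)=0$ and $\psi(x+y)=\psi(x)+\psi(y)$ for all $x,y\in X_l$ (a monoid homomorphism into the additive group $\mathbb{R}$) such that: (i) for each Hilbert space $H$, the restriction of $\psi$ to the fibre $(X_l)_H$ is continuous; (ii) for all pairwise commuting self-adjoint trace-class operators $A_1,\dots,A_l,B$ on a Hilbert space $H$ and every $1\le i\le l$, $$\psi(A_1,\dots,A_i+B,\dots,A_l,H)=\psi(A_1,\dots,A_i,\dots,A_l,H)+\psi(A_1,\dots,B,\dots,A_l,H),$$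 where $B$ stands in the $i$-th place; (iii) if $h:H_1\to H_2$ is a unitary isomorphism of Hilbert spaces, then $\psi(A_1,\dots,A_l,H_1)=\psi(hA_1h^{-1},\dots,hA_lh^{-1},H_2)$; (iv) if $A_1(t),\dots,A_l(t)\in GL_n(\mathbb{R}[t])$ commute pairwise and all the matrices $A_i(0)$ and $A_i(1)$ are positive-definite and symmetric, then $$\psi(\log A_1(0),\dots,\log A_l(0),\mathbb{C}^n)=\psi(\log A_1(1),\dots,\log A_l(1),\mathbb{C}^n),$$ where $\log(SDS^{-1})=S(\log D)S^{-1}$ for $S$ orthogonal and $D$ diagonal with positive entries. Then every trace map on $X_l$ is identically $0$. -/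

import Mathlib

open scoped ENNReal InnerProductSpace

universe u v

set_option linter.unusedSectionVars false

noncomputable section

namespace CommutingTrace

section TraceClass

variable {H : Type u} [NormedAddCommGroup H] [InnerProductSpace ℂ H] [CompleteSpace H]
variable {K : Type v} [NormedAddCommGroup K] [InnerProductSpace ℂ K] [CompleteSpace K]

/-- The number `∑ i, ⟨T (b i), b i⟩`, in `[0, ∞]`, of a (positive) operator `T` with respect to the
Hilbert basis `b`. -/
def traceIn {ι : Type*} (b : HilbertBasis ι ℂ H) (T : H →L[ℂ] H) : ℝ≥0∞ :=
  ∑' i, ENNReal.ofReal (RCLike.re ⟪T (b i), b i⟫_ℂ)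

/-- The trace norm `‖T‖₁ = Tr |T|`, in `[0, ∞]`, where `|T| = (T* T)^(1/2)`. It is computed in some
Hilbert basis; by `traceNorm_eq` below it does not depend on the basis. -/
def traceNorm (T : H →L[ℂ] H) : ℝ≥0∞ :=
  traceIn (exists_hilbertBasis ℂ H).choose_spec.choose (CFC.abs T)

/-- An operator is of trace class if `Tr |T| < ∞`. -/
def IsTraceClass (T : H →L[ℂ] H) : Prop := traceNorm T < ∞

lemma parseval {ι : Type*} (b : HilbertBasis ι ℂ H) (x : H) :
    ENNReal.ofReal (‖x‖ ^ 2) = ∑' i, ENNReal.ofReal (‖⟪b i, x⟫_ℂ‖ ^ 2) := by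
  have h := b.hasSum_inner_mul_inner x x
  have h2 : HasSum (fun i => ‖⟪b i, x⟫_ℂ‖ ^ 2) (‖x‖ ^ 2) := by
    have h3 := Complex.hasSum_re h
    have e : (⟪x, x⟫_ℂ).re = ‖x‖ ^ 2 := by
      rw [inner_self_eq_norm_sq_to_K]; norm_cast
    rw [e] at h3
    convert h3 using 2 with i
    rw [← inner_conj_symm x (b i), mul_comm, Complex.mul_conj, Complex.normSq_eq_norm_sq]
    norm_cast
  rw [← h2.tsum_eq, ENNReal.ofReal_tsum_of_nonneg (fun i => by positivity) h2.summable]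

lemma traceIn_eq {ι κ : Type*} (b : HilbertBasis ι ℂ H) (c : HilbertBasis κ ℂ H)
    {T : H →L[ℂ] H} (hT : 0 ≤ T) : traceIn b T = traceIn c T := by
  set S := CFC.sqrt T with hS
  have hSa : IsSelfAdjoint S := (CFC.sqrt_nonneg T).isSelfAdjoint
  have hsymm : ∀ x y, ⟪S x, y⟫_ℂ = ⟪x, S y⟫_ℂ :=
    ContinuousLinearMap.isSelfAdjoint_iff_isSymmetric.mp hSa
  have hSS : S * S = T := CFC.sqrt_mul_sqrt_self T hT
  have key : ∀ x, RCLike.re ⟪T x, x⟫_ℂ = ‖S x‖ ^ 2 := by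
    intro x
    have e : T x = S (S x) := by rw [← hSS]; rfl
    rw [e, hsymm, inner_self_eq_norm_sq]
  unfold traceIn
  simp only [key]
  simp_rw [parseval c (S (b _)), parseval b (S (c _))]
  rw [ENNReal.tsum_comm]
  refine tsum_congr fun j => tsum_congr fun i => ?_
  rw [← hsymm, ← inner_conj_symm, RCLike.norm_conj]

lemma traceNorm_eq {ι : Type*} (b : HilbertBasis ι ℂ H) (T : H →L[ℂ] H) :
    traceNorm T = traceIn b (CFC.abs T) :=
  traceIn_eq _ _ (CFC.abs_nonneg T)

lemma isTraceClass_of_finiteDimensional [FiniteDimensional ℂ H] (T : H →L[ℂ] H) :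
    IsTraceClass T := by
  unfold IsTraceClass
  rw [traceNorm_eq (stdOrthonormalBasis ℂ H).toHilbertBasis, traceIn, tsum_fintype]
  exact ENNReal.sum_lt_top.mpr fun i _ => ENNReal.ofReal_lt_top

lemma abs_conj (h : H ≃ₗᵢ[ℂ] K) (T : H →L[ℂ] H) :
    CFC.abs (h.conjStarAlgEquiv T) = h.conjStarAlgEquiv (CFC.abs T) := by
  refine CFC.sqrt_unique ?_ ?_
  · rw [← map_mul, CFC.abs_mul_abs, map_mul, map_star]
  · have := CFC.abs_nonneg T
    rw [ContinuousLinearMap.nonneg_iff_isPositive] at this ⊢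
    rw [ContinuousLinearMap.isPositive_def] at this ⊢
    refine ⟨?_, fun x => ?_⟩
    · exact ContinuousLinearMap.isSelfAdjoint_iff_isSymmetric.mp
        ((ContinuousLinearMap.isSelfAdjoint_iff_isSymmetric.mpr this.1).map h.conjStarAlgEquiv)
    · have h1 := this.2 (h.symm x)
      simp only [ContinuousLinearMap.reApplyInnerSelf_apply] at h1 ⊢
      rw [LinearIsometryEquiv.conjStarAlgEquiv_apply_apply, ← h.inner_map_map] at *
      simpa using h1

lemma IsTraceClass.conj {T : H →L[ℂ] H} (hT : IsTraceClass T) (h : H ≃ₗᵢ[ℂ] K) :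
    IsTraceClass (h.conjStarAlgEquiv T) := by
  obtain ⟨w, b, -⟩ := exists_hilbertBasis ℂ H
  have hb : ∀ i, HilbertBasis.ofRepr (h.symm.trans b.repr) i = h (b i) := fun i => rfl
  unfold IsTraceClass at *
  rw [traceNorm_eq b] at hT
  rw [traceNorm_eq (HilbertBasis.ofRepr (h.symm.trans b.repr)), abs_conj]
  unfold traceIn at *
  simpa only [hb, LinearIsometryEquiv.conjStarAlgEquiv_apply_apply,
    LinearIsometryEquiv.symm_apply_apply, LinearIsometryEquiv.inner_map_map] using hT

/-- The sum of two commuting self-adjoint operators of trace class is of trace class. -/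
lemma IsTraceClass.add_of_commute {A B : H →L[ℂ] H} (hA : IsTraceClass A) (hB : IsTraceClass B)
    (sA : IsSelfAdjoint A) (sB : IsSelfAdjoint B) (hc : Commute A B) : IsTraceClass (A + B) := by
  have cab : Commute (CFC.abs A) (CFC.abs B) := hc.cfcAbs_cfcAbs (by rwa [sB.star_eq])
  have h1 : CFC.abs (A * B) = CFC.abs A * CFC.abs B := hc.cfcAbs_mul_eq (by rwa [sB.star_eq])
  have sAB : IsSelfAdjoint (A * B) := (sA.commute_iff sB).mp hc
  have h2 : A * B ≤ CFC.abs A * CFC.abs B := by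
    rw [← h1, ← sub_nonneg, CFC.abs_sub_self _ sAB]
    exact smul_nonneg (by norm_num) (CFC.negPart_nonneg _)
  have hle : CFC.abs (A + B) ≤ CFC.abs A + CFC.abs B := by
    have h3 : CFC.abs A + CFC.abs B
        = CFC.sqrt ((CFC.abs A + CFC.abs B) * (CFC.abs A + CFC.abs B)) :=
      (CFC.sqrt_mul_self _ (add_nonneg (CFC.abs_nonneg A) (CFC.abs_nonneg B))).symm
    rw [h3, CFC.abs]
    refine CFC.sqrt_le_sqrt _ _ ?_
    have e1 : star (A + B) * (A + B) = A * A + B * B + (A * B + A * B) := by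
      rw [star_add, sA.star_eq, sB.star_eq, add_mul, mul_add, mul_add, ← hc.eq]; abel
    have e2 : (CFC.abs A + CFC.abs B) * (CFC.abs A + CFC.abs B)
        = A * A + B * B + (CFC.abs A * CFC.abs B + CFC.abs A * CFC.abs B) := by
      rw [add_mul, mul_add, mul_add, ← cab.eq, CFC.abs_mul_abs, CFC.abs_mul_abs, sA.star_eq,
        sB.star_eq]; abel
    rw [e1, e2]
    gcongr
  have hpt : traceNorm (A + B) ≤ traceNorm A + traceNorm B := by
    unfold traceNorm traceIn
    rw [← ENNReal.tsum_add]
    refine ENNReal.tsum_le_tsum fun i => ?_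
    refine le_trans (ENNReal.ofReal_le_ofReal ?_) ENNReal.ofReal_add_le
    have h4 := (ContinuousLinearMap.le_def _ _).mp hle
    have h5 := h4.re_inner_nonneg_left ((exists_hilbertBasis ℂ H).choose_spec.choose i)
    simp only [sub_apply, add_apply, inner_sub_left,
      inner_add_left, map_sub, map_add] at h5
    linarith
  exact hpt.trans_lt (ENNReal.add_lt_top.mpr ⟨hA, hB⟩)

/-- The operator `A ⊕ B` on the Hilbert space direct sum `H ⊕ K`. -/
def directSum (A : H →L[ℂ] H) (B : K →L[ℂ] K) :
    WithLp 2 (H × K) →L[ℂ] WithLp 2 (H × K) :=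
  (WithLp.prodContinuousLinearEquiv 2 ℂ H K).symm.toContinuousLinearMap ∘L
    (A.prodMap B) ∘L (WithLp.prodContinuousLinearEquiv 2 ℂ H K).toContinuousLinearMap

@[simp] lemma directSum_apply (A : H →L[ℂ] H) (B : K →L[ℂ] K) (x : WithLp 2 (H × K)) :
    directSum A B x = WithLp.toLp 2 (A x.fst, B x.snd) := rfl

lemma directSum_mul (A A' : H →L[ℂ] H) (B B' : K →L[ℂ] K) :
    directSum A B * directSum A' B' = directSum (A * A') (B * B') := rfl

lemma directSum_star (A : H →L[ℂ] H) (B : K →L[ℂ] K) :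
    star (directSum A B) = directSum (star A) (star B) := by
  symm
  rw [ContinuousLinearMap.star_eq_adjoint, ContinuousLinearMap.star_eq_adjoint,
    ContinuousLinearMap.star_eq_adjoint, ContinuousLinearMap.eq_adjoint_iff]
  intro x y
  simp [WithLp.prod_inner_apply, ContinuousLinearMap.adjoint_inner_left]

lemma IsSelfAdjoint.directSum {A : H →L[ℂ] H} {B : K →L[ℂ] K} (hA : IsSelfAdjoint A)
    (hB : IsSelfAdjoint B) : IsSelfAdjoint (directSum A B) := by
  rw [isSelfAdjoint_iff, directSum_star, hA.star_eq, hB.star_eq]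

set_option synthInstance.maxHeartbeats 200000 in
lemma abs_directSum (A : H →L[ℂ] H) (B : K →L[ℂ] K) :
    CFC.abs (directSum A B) = directSum (CFC.abs A) (CFC.abs B) := by
  refine CFC.sqrt_unique ?_ ?_
  · rw [directSum_mul, CFC.abs_mul_abs, CFC.abs_mul_abs, directSum_star, directSum_mul]
  · have hA := CFC.abs_nonneg A
    have hB := CFC.abs_nonneg B
    rw [ContinuousLinearMap.nonneg_iff_isPositive] at hA hB ⊢
    rw [ContinuousLinearMap.isPositive_def]
    refine ⟨ContinuousLinearMap.isSelfAdjoint_iff_isSymmetric.mp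
      (IsSelfAdjoint.directSum hA.isSelfAdjoint hB.isSelfAdjoint), fun x => ?_⟩
    have h1 := hA.re_inner_nonneg_left x.fst
    have h2 := hB.re_inner_nonneg_left x.snd
    rw [ContinuousLinearMap.reApplyInnerSelf_apply, directSum_apply, WithLp.prod_inner_apply,
      map_add]
    exact add_nonneg h1 h2

/-- The Hilbert basis of `H ⊕ K` that is made of Hilbert bases of `H` and of `K`. -/
lemma exists_hilbertBasis_prod {ι κ : Type*} (b : HilbertBasis ι ℂ H) (c : HilbertBasis κ ℂ K) :
    ∃ d : HilbertBasis (ι ⊕ κ) ℂ (WithLp 2 (H × K)),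
      (∀ i, d (Sum.inl i) = WithLp.toLp 2 (b i, 0)) ∧
      (∀ j, d (Sum.inr j) = WithLp.toLp 2 (0, c j)) := by
  let f : ι ⊕ κ → WithLp 2 (H × K) :=
    Sum.elim (fun i => WithLp.toLp 2 (b i, 0)) (fun j => WithLp.toLp 2 (0, c j))
  have hf : Orthonormal ℂ f := by
    classical
    rw [orthonormal_iff_ite]
    have hb := orthonormal_iff_ite.mp b.orthonormal
    have hc := orthonormal_iff_ite.mp c.orthonormal
    rintro (i | i) (j | j) <;> simp [f, WithLp.prod_inner_apply, hb, hc]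
  have hs : (Submodule.span ℂ (Set.range f))ᗮ = ⊥ := by
    rw [Submodule.eq_bot_iff]
    intro x hx
    rw [Submodule.mem_orthogonal] at hx
    have h1 : ∀ i, ⟪b i, x.fst⟫_ℂ = 0 := fun i => by
      simpa [f, WithLp.prod_inner_apply] using hx _ (Submodule.subset_span ⟨Sum.inl i, rfl⟩)
    have h2 : ∀ i, ⟪c i, x.snd⟫_ℂ = 0 := fun i => by
      simpa [f, WithLp.prod_inner_apply] using hx _ (Submodule.subset_span ⟨Sum.inr i, rfl⟩)
    have e1 : x.fst = 0 := by
      have := parseval b x.fst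
      simpa [h1] using this
    have e2 : x.snd = 0 := by
      have := parseval c x.snd
      simpa [h2] using this
    exact (WithLp.ofLp_injective 2) (Prod.ext e1 e2)
  refine ⟨HilbertBasis.mkOfOrthogonalEqBot hf hs, fun i => ?_, fun j => ?_⟩ <;>
    rw [HilbertBasis.coe_mkOfOrthogonalEqBot] <;> rfl

set_option synthInstance.maxHeartbeats 200000 in
lemma traceNorm_directSum (A : H →L[ℂ] H) (B : K →L[ℂ] K) :
    traceNorm (directSum A B) = traceNorm A + traceNorm B := by
  obtain ⟨w, b, -⟩ := exists_hilbertBasis ℂ H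
  obtain ⟨w', c, -⟩ := exists_hilbertBasis ℂ K
  obtain ⟨d, h1, h2⟩ := exists_hilbertBasis_prod b c
  rw [traceNorm_eq b, traceNorm_eq c, traceNorm_eq d, abs_directSum, traceIn,
    ENNReal.summable.tsum_sum ENNReal.summable]
  simp [traceIn, h1, h2, WithLp.prod_inner_apply]

lemma IsTraceClass.directSum {A : H →L[ℂ] H} {B : K →L[ℂ] K} (hA : IsTraceClass A)
    (hB : IsTraceClass B) : IsTraceClass (directSum A B) := by
  unfold IsTraceClass
  rw [traceNorm_directSum]
  exact ENNReal.add_lt_top.mpr ⟨hA, hB⟩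

end TraceClass

/-- The fibre `(X_l)_H`: the `l`-tuples of pairwise commuting self-adjoint operators of trace class
on the complex Hilbert space `H`. -/
structure Fibre (l : ℕ) (H : Type u) [NormedAddCommGroup H] [InnerProductSpace ℂ H]
    [CompleteSpace H] where
  op : Fin l → H →L[ℂ] H
  isSelfAdjoint : ∀ i, IsSelfAdjoint (op i)
  isTraceClass : ∀ i, IsTraceClass (op i)
  commute : ∀ i j, Commute (op i) (op j)

namespace Fibre

variable {l : ℕ}
variable {H : Type u} [NormedAddCommGroup H] [InnerProductSpace ℂ H] [CompleteSpace H]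
variable {K : Type v} [NormedAddCommGroup K] [InnerProductSpace ℂ K] [CompleteSpace K]

/-- The tuple `(A_1 ⊕ B_1, …, A_l ⊕ B_l)` on `H ⊕ K`. -/
def sum (A : Fibre l H) (B : Fibre l K) : Fibre l (WithLp 2 (H × K)) where
  op i := directSum (A.op i) (B.op i)
  isSelfAdjoint i := IsSelfAdjoint.directSum (A.isSelfAdjoint i) (B.isSelfAdjoint i)
  isTraceClass i := (A.isTraceClass i).directSum (B.isTraceClass i)
  commute i j := by
    rw [commute_iff_eq, directSum_mul, directSum_mul, (A.commute i j).eq, (B.commute i j).eq]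

/-- The tuple `(h A_1 h⁻¹, …, h A_l h⁻¹)` for a unitary isomorphism `h : H → K`. -/
def conj (h : H ≃ₗᵢ[ℂ] K) (A : Fibre l H) : Fibre l K where
  op i := h.conjStarAlgEquiv (A.op i)
  isSelfAdjoint i := (A.isSelfAdjoint i).map h.conjStarAlgEquiv
  isTraceClass i := (A.isTraceClass i).conj h
  commute i j := (A.commute i j).map h.conjStarAlgEquiv

/-- The tuple `(A_1, …, A_{i-1}, B, A_{i+1}, …, A_l)`, for a self-adjoint operator `B` of trace
class that commutes with all `A_j`. -/
def replace (A : Fibre l H) (i : Fin l) (B : H →L[ℂ] H) (hs : IsSelfAdjoint B)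
    (ht : IsTraceClass B) (hc : ∀ j, Commute (A.op j) B) : Fibre l H where
  op := Function.update A.op i B
  isSelfAdjoint j := by
    rcases eq_or_ne j i with rfl | h
    · simpa using hs
    · simpa [h] using A.isSelfAdjoint j
  isTraceClass j := by
    rcases eq_or_ne j i with rfl | h
    · simpa using ht
    · simpa [h] using A.isTraceClass j
  commute j k := by
    rcases eq_or_ne j i with rfl | h <;> rcases eq_or_ne k j with rfl | h'
    · exact Commute.refl _
    · simpa [h'] using (hc k).symm
    · exact Commute.refl _
    · rcases eq_or_ne k i with rfl | h''
      · simpa [h] using hc j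
      · simpa [h, h''] using A.commute j k

/-- The tuple `(A_1, …, A_{i-1}, A_i + B, A_{i+1}, …, A_l)`. -/
def addAt (A : Fibre l H) (i : Fin l) (B : H →L[ℂ] H) (hs : IsSelfAdjoint B)
    (ht : IsTraceClass B) (hc : ∀ j, Commute (A.op j) B) : Fibre l H :=
  A.replace i (A.op i + B) ((A.isSelfAdjoint i).add hs)
    ((A.isTraceClass i).add_of_commute ht (A.isSelfAdjoint i) hs (hc i))
    (fun j => (A.commute j i).add_right (hc j))

end Fibre

/-- The elements of `X_l`: symbols `(A_1, …, A_l, H)` with `H` a complex Hilbert space and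
`(A_1, …, A_l)` in the fibre over `H`. -/
structure X (l : ℕ) where
  {H : Type u}
  [instNormedAddCommGroup : NormedAddCommGroup H]
  [instInnerProductSpace : InnerProductSpace ℂ H]
  [instCompleteSpace : CompleteSpace H]
  tuple : Fibre l H

attribute [instance] X.instNormedAddCommGroup X.instInnerProductSpace X.instCompleteSpace

/-- The Hilbert space `ℂⁿ`; the index type is lifted so that it lives in a given universe. -/
abbrev Cn (n : ℕ) : Type u := EuclideanSpace ℂ (ULift.{u} (Fin n))

/-- The symbol of the zero operators on `ℂ⁰`, the neutral element of `X_l`. -/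
instance (l : ℕ) : Zero (X.{u} l) :=
  ⟨⟨{ op := fun _ => (0 : Cn.{u} 0 →L[ℂ] Cn.{u} 0)
      isSelfAdjoint := fun _ => IsSelfAdjoint.zero _
      isTraceClass := fun _ => isTraceClass_of_finiteDimensional _
      commute := fun _ _ => Commute.refl _ }⟩⟩

/-- The addition `(A, H) + (B, K) = (A ⊕ B, H ⊕ K)` of `X_l`. -/
instance (l : ℕ) : Add (X.{u} l) := ⟨fun x y => ⟨x.tuple.sum y.tuple⟩⟩

section Log

variable {n : ℕ}

/-- The logarithm `S (log D) S⁻¹` of a positive-definite symmetric real matrix `S D S⁻¹`, where `S`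
is orthogonal and `D` is diagonal. -/
def matrixLog {M : Matrix (Fin n) (Fin n) ℝ} (hM : M.PosDef) : Matrix (Fin n) (Fin n) ℝ :=
  hM.isHermitian.cfc Real.log

/-- A real matrix, as an operator on `ℂⁿ`. -/
def toOperator (M : Matrix (Fin n) (Fin n) ℝ) : Cn.{u} n →L[ℂ] Cn.{u} n :=
  Matrix.toEuclideanCLM (n := ULift.{u} (Fin n)) (𝕜 := ℂ)
    ((M.map Complex.ofReal).submatrix ULift.down ULift.down)

lemma isSelfAdjoint_matrixLog {M : Matrix (Fin n) (Fin n) ℝ} (hM : M.PosDef) :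
    IsSelfAdjoint (matrixLog hM) := by
  rw [matrixLog, ← Matrix.IsHermitian.cfc_eq]
  exact cfc_predicate _ _

lemma commute_matrixLog {M N : Matrix (Fin n) (Fin n) ℝ} (hM : M.PosDef) (hN : N.PosDef)
    (h : Commute M N) : Commute (matrixLog hM) (matrixLog hN) := by
  rw [matrixLog, matrixLog, ← Matrix.IsHermitian.cfc_eq, ← Matrix.IsHermitian.cfc_eq]
  exact ((h.cfc_real Real.log).symm.cfc_real Real.log).symm

lemma toOperator_mul (M N : Matrix (Fin n) (Fin n) ℝ) :
    toOperator.{u} (M * N) = toOperator M * toOperator N := by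
  unfold toOperator
  rw [← map_mul]
  congr 1
  have : (M * N).map Complex.ofReal = M.map Complex.ofReal * N.map Complex.ofReal :=
    Matrix.map_mul (f := Complex.ofRealHom)
  rw [this]
  exact Matrix.submatrix_mul _ _ _ _ _ Equiv.ulift.bijective

lemma isSelfAdjoint_toOperator {M : Matrix (Fin n) (Fin n) ℝ} (hM : IsSelfAdjoint M) :
    IsSelfAdjoint (toOperator.{u} M) := by
  refine IsSelfAdjoint.map ?_ _
  ext i j
  have := congrFun (congrFun hM.star_eq i.down) j.down
  simp only [Matrix.star_apply, star_trivial] at this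
  simp [Matrix.star_apply, this]

/-- The tuple `(log M_1, …, log M_l)` on `ℂⁿ`, for commuting positive-definite symmetric real
matrices `M_1, …, M_l`. -/
def logTuple {l : ℕ} {M : Fin l → Matrix (Fin n) (Fin n) ℝ} (hM : ∀ i, (M i).PosDef)
    (hc : ∀ i j, Commute (M i) (M j)) : Fibre l (Cn.{u} n) where
  op i := toOperator (matrixLog (hM i))
  isSelfAdjoint i := isSelfAdjoint_toOperator (isSelfAdjoint_matrixLog (hM i))
  isTraceClass _ := isTraceClass_of_finiteDimensional _
  commute i j := by
    rw [commute_iff_eq, ← toOperator_mul, ← toOperator_mul,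
      (commute_matrixLog (hM i) (hM j) (hc i j)).eq]

/-- The value `A(t)` at the real number `t` of a matrix `A` over `ℝ[t]`. -/
def evalAt (t : ℝ) (A : Matrix.GeneralLinearGroup (Fin n) (Polynomial ℝ)) :
    Matrix (Fin n) (Fin n) ℝ :=
  (Polynomial.evalRingHom t).mapMatrix (A : Matrix (Fin n) (Fin n) (Polynomial ℝ))

lemma commute_evalAt (t : ℝ) {A B : Matrix.GeneralLinearGroup (Fin n) (Polynomial ℝ)}
    (h : Commute A B) : Commute (evalAt t A) (evalAt t B) :=
  (h.units_val).map (Polynomial.evalRingHom t).mapMatrix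

end Log

/-- A trace map on `X_l`: a homomorphism of `X_l` to the additive group `ℝ` that is continuous for
the trace norm on each fibre, additive in each slot, invariant under unitary isomorphisms and
invariant under polynomial homotopies. -/
structure IsTraceMap {l : ℕ} (ψ : X.{u} l → ℝ) : Prop where
  map_zero : ψ 0 = 0
  map_add : ∀ x y : X.{u} l, ψ (x + y) = ψ x + ψ y
  continuous : ∀ (H : Type u) [NormedAddCommGroup H] [InnerProductSpace ℂ H] [CompleteSpace H]
    (A : Fibre l H), ∀ ε : ℝ, 0 < ε → ∃ δ : ℝ, 0 < δ ∧ ∀ B : Fibre l H,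
      (∀ i, traceNorm (B.op i - A.op i) < ENNReal.ofReal δ) → |ψ ⟨B⟩ - ψ ⟨A⟩| < ε
  additive : ∀ (H : Type u) [NormedAddCommGroup H] [InnerProductSpace ℂ H] [CompleteSpace H]
    (A : Fibre l H) (i : Fin l) (B : H →L[ℂ] H) (hs : IsSelfAdjoint B) (ht : IsTraceClass B)
    (hc : ∀ j, Commute (A.op j) B),
      ψ ⟨A.addAt i B hs ht hc⟩ = ψ ⟨A⟩ + ψ ⟨A.replace i B hs ht hc⟩
  unitary : ∀ (H K : Type u) [NormedAddCommGroup H] [InnerProductSpace ℂ H] [CompleteSpace H]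
    [NormedAddCommGroup K] [InnerProductSpace ℂ K] [CompleteSpace K] (h : H ≃ₗᵢ[ℂ] K)
    (A : Fibre l H), ψ ⟨A⟩ = ψ ⟨A.conj h⟩
  homotopy : ∀ (n : ℕ) (A : Fin l → Matrix.GeneralLinearGroup (Fin n) (Polynomial ℝ))
    (hc : ∀ i j, Commute (A i) (A j)) (h₀ : ∀ i, (evalAt 0 (A i)).PosDef)
    (h₁ : ∀ i, (evalAt 1 (A i)).PosDef),
      ψ ⟨logTuple h₀ fun i j => commute_evalAt 0 (hc i j)⟩ =
        ψ ⟨logTuple h₁ fun i j => commute_evalAt 1 (hc i j)⟩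

end CommutingTrace

end

noncomputable section

namespace CommutingTrace

/-! ### Additivity along invariant orthogonal decompositions -/

section Splitting

variable {l : ℕ}
variable {H : Type u} [NormedAddCommGroup H] [InnerProductSpace ℂ H] [CompleteSpace H]
variable {K : Type u} [NormedAddCommGroup K] [InnerProductSpace ℂ K] [CompleteSpace K]
variable {L : Type u} [NormedAddCommGroup L] [InnerProductSpace ℂ L] [CompleteSpace L]

/-! Commuting self-adjoint trace-class operators can be approximated in trace norm by commuting
finite-rank ones, and those are simultaneously diagonalisable. Continuity, additivity and unitary
invariance therefore reduce the claim to tuples of real scalars on `ℂ¹`. There the trace map is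
additive and continuous in each slot, hence ℝ-multilinear, so its value at `a` is `(∏ i, a i) * c`
for a single constant `c` (`scalarValue_mul`).

Homotopy invariance forces `c = 0` (`scalarValue_eq_zero`). A polynomial path in `SL₂` joins the
identity to `diag(2, 1/2)`. In a single slot this gives no information, since `log 2 + log (1/2) =
0`. With the same path in two slots, which commutes with itself, the logarithms enter as squares:
the two eigenlines contribute equally at the far end, while the near end contributes zero. Constant
paths at the scalar 2 fill the remaining slots. This is where `2 ≤ l` is decisive.

The approximation applies a soft threshold through the functional calculus. Truncations commute,
have finite rank because `|A| ≥ ε` on their range (`finiteDimensional_range_cfc_softThreshold`), and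
converge in trace norm by dominated convergence (`tendsto_traceNorm_cfc_softThreshold_sub`). -/

lemma Fibre.eq_of_op_eq {A B : Fibre l H} (h : ∀ i, A.op i = B.op i) : A = B := by
  cases A; cases B
  congr
  exact funext h

lemma directSum_injective {A A' : H →L[ℂ] H} {B B' : K →L[ℂ] K}
    (h : directSum A B = directSum A' B') : A = A' ∧ B = B' := by
  constructor
  · ext x
    have := DFunLike.congr_fun h (WithLp.toLp 2 (x, 0))
    simp only [directSum_apply] at this
    exact congrArg (fun z : WithLp 2 (H × K) => z.fst) this
  · ext x
    have := DFunLike.congr_fun h (WithLp.toLp 2 (0, x))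
    simp only [directSum_apply] at this
    exact congrArg (fun z : WithLp 2 (H × K) => z.snd) this

/-- Slot additivity in a form that compares three tuples entry by entry, avoiding `addAt` and
`replace`. Commutation is only asked for in slot `i`: in every other slot `A` and `B` agree, so it
follows from the commutation within `B`. -/
lemma IsTraceMap.eq_add_of_op {ψ : X.{u} l → ℝ} (hψ : IsTraceMap ψ) {A B C : Fibre l H}
    (i : Fin l) (hc : Commute (A.op i) (B.op i)) (hi : C.op i = A.op i + B.op i)
    (hA : ∀ j, j ≠ i → C.op j = A.op j) (hB : ∀ j, j ≠ i → C.op j = B.op j) :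
    ψ ⟨C⟩ = ψ ⟨A⟩ + ψ ⟨B⟩ := by
  have hc' : ∀ j, Commute (A.op j) (B.op i) := fun j => by
    rcases eq_or_ne j i with rfl | h
    · exact hc
    · rw [← hA j h, hB j h]; exact B.commute j i
  have key := hψ.additive H A i (B.op i) (B.isSelfAdjoint i) (B.isTraceClass i) hc'
  have e1 : A.addAt i (B.op i) (B.isSelfAdjoint i) (B.isTraceClass i) hc' = C := by
    refine Fibre.eq_of_op_eq fun j => ?_
    rcases eq_or_ne j i with rfl | h
    · simp [Fibre.addAt, Fibre.replace, hi]
    · simp [Fibre.addAt, Fibre.replace, h, hA j h]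
  have e2 : A.replace i (B.op i) (B.isSelfAdjoint i) (B.isTraceClass i) hc' = B := by
    refine Fibre.eq_of_op_eq fun j => ?_
    rcases eq_or_ne j i with rfl | h
    · simp [Fibre.replace]
    · simp [Fibre.replace, h, ← hA j h, hB j h]
  rwa [e1, e2] at key

/-- A tuple with a zero entry has trace zero. -/
lemma IsTraceMap.eq_zero_of_op_eq_zero {ψ : X.{u} l → ℝ} (hψ : IsTraceMap ψ) (A : Fibre l H)
    (i : Fin l) (h : A.op i = 0) : ψ ⟨A⟩ = 0 := by
  have := hψ.eq_add_of_op (A := A) (B := A) (C := A) i (Commute.refl _) (by simp [h])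
    (fun _ _ => rfl) (fun _ _ => rfl)
  linarith

/-- Adjoints and products of direct sums are formed blockwise and `directSum` is injective, so
self-adjointness and commutation pass to the blocks. Trace class passes because the trace norm is
additive on direct sums. -/
lemma IsTraceMap.exists_eq_add {ψ : X.{u} l → ℝ} (hψ : IsTraceMap ψ) (A : Fibre l H)
    (h : H ≃ₗᵢ[ℂ] WithLp 2 (K × L)) (B : Fin l → K →L[ℂ] K) (C : Fin l → L →L[ℂ] L)
    (hA : ∀ i, h.conjStarAlgEquiv (A.op i) = directSum (B i) (C i)) :
    ∃ (B' : Fibre l K) (C' : Fibre l L), B'.op = B ∧ C'.op = C ∧ ψ ⟨A⟩ = ψ ⟨B'⟩ + ψ ⟨C'⟩ := by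
  have hs : ∀ i, star (B i) = B i ∧ star (C i) = C i := fun i => by
    refine directSum_injective ?_
    rw [← directSum_star, ← hA]
    exact ((A.conj h).isSelfAdjoint i).star_eq
  have ht : ∀ i, IsTraceClass (B i) ∧ IsTraceClass (C i) := fun i => by
    have := (A.conj h).isTraceClass i
    change IsTraceClass (h.conjStarAlgEquiv (A.op i)) at this
    rw [hA, IsTraceClass, traceNorm_directSum] at this
    exact ENNReal.add_lt_top.mp this
  have hc : ∀ i j, B i * B j = B j * B i ∧ C i * C j = C j * C i := fun i j => by
    refine directSum_injective ?_
    rw [← directSum_mul, ← directSum_mul, ← hA, ← hA]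
    exact ((A.conj h).commute i j).eq
  refine ⟨⟨B, fun i => (hs i).1, fun i => (ht i).1, fun i j => (hc i j).1⟩,
    ⟨C, fun i => (hs i).2, fun i => (ht i).2, fun i j => (hc i j).2⟩, rfl, rfl, ?_⟩
  rw [← hψ.map_add, hψ.unitary _ _ h A]
  congr 2
  exact Fibre.eq_of_op_eq hA

/-- A trace map is additive along the decomposition of `H` into an invariant closed subspace and
its orthogonal complement. -/
lemma IsTraceMap.exists_eq_add_of_invariant {ψ : X.{u} l → ℝ} (hψ : IsTraceMap ψ)
    (A : Fibre l H) (V : Submodule ℂ H) [CompleteSpace V] (hV : ∀ i, ∀ x ∈ V, A.op i x ∈ V) :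
    ∃ (B : Fibre l V) (C : Fibre l Vᗮ), (∀ i (x : V), (B.op i x : H) = A.op i x) ∧
      (∀ i (x : Vᗮ), (C.op i x : H) = A.op i x) ∧ ψ ⟨A⟩ = ψ ⟨B⟩ + ψ ⟨C⟩ := by
  have hV' : ∀ i, ∀ x ∈ Vᗮ, A.op i x ∈ Vᗮ := fun i x hx => by
    rw [Submodule.mem_orthogonal] at hx ⊢
    intro y hy
    have hsym := ContinuousLinearMap.isSelfAdjoint_iff_isSymmetric.mp (A.isSelfAdjoint i)
    exact (hsym y x).symm.trans (hx _ (hV i y hy))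
  obtain ⟨B, C, hB, hC, e⟩ := hψ.exists_eq_add A V.orthogonalDecomposition
    (fun i => ((A.op i).comp V.subtypeL).codRestrict V fun x => hV i x x.2)
    (fun i => ((A.op i).comp Vᗮ.subtypeL).codRestrict Vᗮ fun x => hV' i x x.2) (fun i => by
      ext x : 1
      rw [LinearIsometryEquiv.conjStarAlgEquiv_apply_apply]
      rw [← LinearIsometryEquiv.eq_symm_apply]
      simp [Submodule.orthogonalDecomposition_symm_apply]
      rfl)
  refine ⟨B, C, fun i x => ?_, fun i x => ?_, e⟩
  · rw [hB]; rfl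
  · rw [hC]; rfl

end Splitting

/-! ### Scalar tuples and multilinearity -/

section Scalar

variable {l : ℕ}

/-- The tuple of the real scalars `a_1, …, a_l` on a finite-dimensional space. -/
def Fibre.scalar (H : Type u) [NormedAddCommGroup H] [InnerProductSpace ℂ H] [CompleteSpace H]
    [FiniteDimensional ℂ H] (a : Fin l → ℝ) : Fibre l H where
  op i := (a i : ℂ) • 1
  isSelfAdjoint i := by simp [isSelfAdjoint_iff]
  isTraceClass _ := isTraceClass_of_finiteDimensional _
  commute i j := ((Commute.one_left _).smul_right _).smul_left _

/-- Turns trace-norm continuity on the fibre over `ℂ¹` into ordinary continuity in a real variable.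
-/
lemma traceNorm_smul_one (c : ℝ) :
    traceNorm ((c : ℂ) • (1 : Cn.{u} 1 →L[ℂ] Cn.{u} 1)) = ENNReal.ofReal |c| := by
  have e : CFC.abs ((c : ℂ) • (1 : Cn.{u} 1 →L[ℂ] Cn.{u} 1)) = |c| • 1 := by
    rw [CFC.abs_smul]; simp
  rw [traceNorm_eq (EuclideanSpace.basisFun (ULift.{u} (Fin 1)) ℂ).toHilbertBasis, e, traceIn,
    tsum_fintype]
  simp

/-- The value of a trace map on scalars on `ℂ¹`. -/
def scalarValue (ψ : X.{u} l → ℝ) (a : Fin l → ℝ) : ℝ := ψ ⟨Fibre.scalar (Cn.{u} 1) a⟩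

lemma IsTraceMap.scalarValue_update_add {ψ : X.{u} l → ℝ} (hψ : IsTraceMap ψ) (a : Fin l → ℝ)
    (i : Fin l) (s t : ℝ) : scalarValue ψ (Function.update a i (s + t)) =
      scalarValue ψ (Function.update a i s) + scalarValue ψ (Function.update a i t) := by
  refine hψ.eq_add_of_op i (((Commute.one_left _).smul_right _).smul_left _) ?_
    (fun j h => ?_) (fun j h => ?_)
  · simp [Fibre.scalar, add_smul]
  · simp [Fibre.scalar, h]
  · simp [Fibre.scalar, h]

lemma IsTraceMap.continuous_scalarValue_update {ψ : X.{u} l → ℝ} (hψ : IsTraceMap ψ)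
    (a : Fin l → ℝ) (i : Fin l) : Continuous fun t => scalarValue ψ (Function.update a i t) := by
  rw [Metric.continuous_iff]
  intro t ε hε
  obtain ⟨δ, hδ, h⟩ := hψ.continuous _ (Fibre.scalar (Cn.{u} 1) (Function.update a i t)) ε hε
  refine ⟨δ, hδ, fun s hs => h (Fibre.scalar (Cn.{u} 1) (Function.update a i s)) fun j => ?_⟩
  simp only [Fibre.scalar]
  rw [← sub_smul, ← Complex.ofReal_sub, traceNorm_smul_one]
  refine (ENNReal.ofReal_lt_ofReal_iff hδ).mpr ?_
  rcases eq_or_ne j i with rfl | h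
  · simpa [Real.dist_eq] using hs
  · simpa [h] using hδ

/-- A continuous additive map between real topological vector spaces is ℝ-linear. -/
lemma IsTraceMap.scalarValue_update_smul {ψ : X.{u} l → ℝ} (hψ : IsTraceMap ψ) (a : Fin l → ℝ)
    (i : Fin l) (c t : ℝ) : scalarValue ψ (Function.update a i (c • t)) =
      c • scalarValue ψ (Function.update a i t) :=
  map_real_smul (AddMonoidHom.mk' (fun t => scalarValue ψ (Function.update a i t))
    (hψ.scalarValue_update_add a i)) (hψ.continuous_scalarValue_update a i) c t

lemma IsTraceMap.scalarValue_mul {ψ : X.{u} l → ℝ} (hψ : IsTraceMap ψ) (c a : Fin l → ℝ) :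
    scalarValue ψ (fun i => c i * a i) = (∏ i, c i) * scalarValue ψ a :=
  MultilinearMap.map_smul_univ (MultilinearMap.mk' (R := ℝ) (M₁ := fun _ : Fin l => ℝ)
    (scalarValue ψ) (fun a i s t => hψ.scalarValue_update_add a i s t)
    (fun a i c t => hψ.scalarValue_update_smul a i c t)) c a

/-- On a one-dimensional space, a trace map is determined by the eigenvalues. -/
lemma IsTraceMap.eq_scalarValue {ψ : X.{u} l → ℝ} (hψ : IsTraceMap ψ)
    {H : Type u} [NormedAddCommGroup H] [InnerProductSpace ℂ H] [CompleteSpace H]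
    (hH : Module.finrank ℂ H = 1) (A : Fibre l H) {v : H} (hv : v ≠ 0) (a : Fin l → ℝ)
    (hA : ∀ i, A.op i v = (a i : ℂ) • v) : ψ ⟨A⟩ = scalarValue ψ a := by
  have : FiniteDimensional ℂ H := .of_finrank_pos (by omega)
  -- Any unitary will do, since conjugation fixes scalar operators.
  have h : H ≃ₗᵢ[ℂ] Cn.{u} 1 :=
    ((stdOrthonormalBasis ℂ H).reindex ((finCongr hH).trans Equiv.ulift.symm)).repr
  rw [hψ.unitary _ _ h A, scalarValue]
  refine congrArg _ (congrArg _ (Fibre.eq_of_op_eq fun i => ?_))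
  ext1 y
  obtain ⟨c, hc⟩ := (finrank_eq_one_iff_of_nonzero' v hv).mp hH (h.symm y)
  change h (A.op i (h.symm y)) = (a i : ℂ) • y
  rw [← hc, map_smul, hA, smul_comm, map_smul, hc, h.apply_symm_apply]

end Scalar

/-! ### The polynomial homotopy and the vanishing on scalars -/

section Homotopy

open Polynomial

variable {l : ℕ}

/-- The eigenvector matrix `U` satisfies `diag(d) U = U diag(λ)`, so `d i = λ j` wherever `U i j ≠
0`. Hence `U` also intertwines the logarithms, and no matching of the order of the eigenvalues is
needed. -/
lemma matrixLog_diagonal {n : ℕ} {M : Matrix (Fin n) (Fin n) ℝ} (hM : M.PosDef) (d : Fin n → ℝ)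
    (h : M = Matrix.diagonal d) : matrixLog hM = Matrix.diagonal fun i => Real.log (d i) := by
  have hH := hM.isHermitian
  set U : Matrix (Fin n) (Fin n) ℝ := hH.eigenvectorUnitary.1 with hU
  have hUU : U * star U = 1 := Unitary.coe_mul_star_self _
  have hU' : star U * U = 1 := Unitary.coe_star_mul_self _
  have h1 : M = U * Matrix.diagonal hH.eigenvalues * star U := by
    have := hH.spectral_theorem
    simpa [Unitary.conjStarAlgAut_apply, Function.comp_def] using this
  have h2 : Matrix.diagonal d * U = U * Matrix.diagonal hH.eigenvalues := by
    rw [← h]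
    conv_lhs => rw [h1]
    rw [Matrix.mul_assoc, hU', Matrix.mul_one]
  have h3 : (Matrix.diagonal fun i => Real.log (d i)) * U =
      U * Matrix.diagonal fun i => Real.log (hH.eigenvalues i) := by
    ext i j
    have := congrFun (congrFun h2 i) j
    rw [Matrix.diagonal_mul, Matrix.mul_diagonal] at this ⊢
    by_cases hz : U i j = 0
    · simp [hz]
    · rw [mul_comm] at this
      rw [mul_left_cancel₀ hz this, mul_comm]
  have h4 : matrixLog hM = U * (Matrix.diagonal fun i => Real.log (hH.eigenvalues i)) * star U := by
    simp [matrixLog, Matrix.IsHermitian.cfc, Unitary.conjStarAlgAut_apply, Function.comp_def, hU]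
  rw [h4, ← h3, Matrix.mul_assoc, hUU, Matrix.mul_one]

lemma toOperator_diagonal_single {n : ℕ} (d : Fin n → ℝ) (k : ULift.{u} (Fin n)) :
    toOperator.{u} (Matrix.diagonal d) (EuclideanSpace.single k 1) =
      (d k.down : ℂ) • EuclideanSpace.single k (1 : ℂ) := by
  ext j
  rw [toOperator]
  simp only [Matrix.ofLp_toEuclideanCLM]
  by_cases h : j = k
  · subst h; simp [Matrix.mulVec_single, Matrix.col]
  · have : j.down ≠ k.down := fun e => h (ULift.down_injective e)
    simp [Matrix.mulVec_single, Matrix.col, h, Matrix.diagonal_apply_ne' _ this]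

lemma IsTraceMap.logTuple_diagonal {ψ : X.{u} l → ℝ} (hψ : IsTraceMap ψ)
    {M : Fin l → Matrix (Fin 2) (Fin 2) ℝ} (hM : ∀ i, (M i).PosDef)
    (hc : ∀ i j, Commute (M i) (M j)) (d : Fin l → Fin 2 → ℝ)
    (h : ∀ i, M i = Matrix.diagonal (d i)) :
    ψ ⟨logTuple hM hc⟩ = scalarValue ψ (fun i => Real.log (d i 0)) +
      scalarValue ψ (fun i => Real.log (d i 1)) := by
  let e : Fin 2 → Cn.{u} 2 := fun k => EuclideanSpace.single ⟨k⟩ 1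
  have he : ∀ i k, (logTuple.{u} hM hc).op i (e k) = (Real.log (d i k) : ℂ) • e k := fun i k => by
    change toOperator (matrixLog (hM i)) (e k) = _
    rw [matrixLog_diagonal (hM i) (d i) (h i), toOperator_diagonal_single]
  have hne : ∀ k, e k ≠ 0 := fun k => by simp [e]
  have : Fact (Module.finrank ℂ (Cn.{u} 2) = 1 + 1) := ⟨by simp⟩
  obtain ⟨B, C, hB, hC, key⟩ := hψ.exists_eq_add_of_invariant (logTuple hM hc)
    (Submodule.span ℂ {e 0}) (fun i x hx => by
      obtain ⟨c, rfl⟩ := Submodule.mem_span_singleton.mp hx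
      rw [map_smul, he]
      exact Submodule.smul_mem _ _ (Submodule.smul_mem _ _ (Submodule.mem_span_singleton_self _)))
  have h1 : e 1 ∈ (Submodule.span ℂ {e 0})ᗮ := by
    rw [Submodule.mem_orthogonal_singleton_iff_inner_right]
    simp [e, EuclideanSpace.inner_single_left]
  rw [key, hψ.eq_scalarValue (finrank_span_singleton (hne 0)) B
      (v := ⟨e 0, Submodule.mem_span_singleton_self _⟩) (by simpa using hne 0) _ (fun i => ?_),
    hψ.eq_scalarValue (Submodule.finrank_orthogonal_span_singleton (hne 0)) C
      (v := ⟨e 1, h1⟩) (by simpa using hne 1) _ (fun i => ?_)]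
  · exact Subtype.ext ((hC i _).trans (he i 1))
  · exact Subtype.ext ((hB i _).trans (he i 0))

/-- A polynomial path in `SL₂` from the identity to `diag(2, 1/2)`. -/
def hyperbolicPath : Matrix.GeneralLinearGroup (Fin 2) ℝ[X] :=
  Matrix.GeneralLinearGroup.mk''
    !![1 + Polynomial.X ^ 4, C (1 / 2) * (Polynomial.X - Polynomial.X ^ 3);
      Polynomial.X ^ 3 - Polynomial.X, 1 - C (1 / 2) * Polynomial.X ^ 2] (by
      have h : (2 : ℝ[X]) * C (1 / 2) = 1 := by
        rw [← C_ofNat, ← C_mul]; norm_num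
      have : Matrix.det !![1 + Polynomial.X ^ 4, C (1 / 2) * (Polynomial.X - Polynomial.X ^ 3);
          Polynomial.X ^ 3 - Polynomial.X, 1 - C (1 / 2) * Polynomial.X ^ 2] = (1 : ℝ[X]) := by
        rw [Matrix.det_fin_two_of]
        -- With `c = C (1 / 2)`, the terms in `X ^ 2` and `X ^ 6` cancel identically, leaving `X ^ 4
        -- - 2 * c * X ^ 4`.
        linear_combination (-Polynomial.X ^ 4) * h
      rw [this]
      exact isUnit_one)

/-- The constant path at the scalar matrix `2`. -/
def constTwo : Matrix.GeneralLinearGroup (Fin 2) ℝ[X] :=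
  Matrix.GeneralLinearGroup.mk'' (C (2 : ℝ) • 1) (by
    rw [Matrix.det_smul, Matrix.det_one, mul_one]
    exact (Polynomial.isUnit_C.mpr (by norm_num)).pow _)

lemma commute_constTwo (A : Matrix.GeneralLinearGroup (Fin 2) ℝ[X]) : Commute constTwo A := by
  refine Units.ext ?_
  change (C (2 : ℝ) • (1 : Matrix (Fin 2) (Fin 2) ℝ[X])) * A.val =
    A.val * (C (2 : ℝ) • (1 : Matrix (Fin 2) (Fin 2) ℝ[X]))
  simp

lemma evalAt_hyperbolicPath (t : ℝ) : evalAt t hyperbolicPath =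
    !![1 + t ^ 4, 1 / 2 * (t - t ^ 3); t ^ 3 - t, 1 - 1 / 2 * t ^ 2] := by
  ext i j
  fin_cases i <;> fin_cases j <;>
    simp [evalAt, hyperbolicPath, Matrix.GeneralLinearGroup.mk'', Matrix.nonsingInvUnit]

lemma evalAt_constTwo (t : ℝ) : evalAt t constTwo = Matrix.diagonal ![2, 2] := by
  ext i j
  fin_cases i <;> fin_cases j <;>
    simp [evalAt, constTwo, Matrix.GeneralLinearGroup.mk'', Matrix.nonsingInvUnit]

/-- The off-diagonal entries of `hyperbolicPath` vanish at 0 and 1, so both endpoints are diagonal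
and can be evaluated by multilinearity; between them the path need not be symmetric. -/
lemma IsTraceMap.scalarValue_eq_zero {ψ : X.{u} l → ℝ} (hψ : IsTraceMap ψ) (hl : 2 ≤ l)
    (a : Fin l → ℝ) : scalarValue ψ a = 0 := by
  obtain ⟨m, rfl⟩ : ∃ m, l = m + 2 := ⟨l - 2, by omega⟩
  have hone : ∀ a : Fin (m + 2) → ℝ, scalarValue ψ a = (∏ i, a i) * scalarValue ψ 1 := fun a => by
    simpa using hψ.scalarValue_mul a 1
  -- Exactly two slots carry the path, so the sign of `log (1/2)` occurs squared for every `m`; the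
  -- other slots contribute the nonzero factor `log 2`.
  let A : Fin (m + 2) → Matrix.GeneralLinearGroup (Fin 2) ℝ[X] :=
    Fin.cons hyperbolicPath (Fin.cons hyperbolicPath fun _ => constTwo)
  have hc : ∀ i j, Commute (A i) (A j) := by
    have h : ∀ i, A i = hyperbolicPath ∨ A i = constTwo := fun i => by
      refine Fin.cases (by simp [A]) (fun i => Fin.cases (by simp [A]) (fun i => ?_) i) i
      right; rfl
    intro i j
    rcases h i with hi | hi <;> rcases h j with hj | hj <;> rw [hi, hj]
    · exact (commute_constTwo _).symm
    · exact commute_constTwo _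
  let d₀ : Fin (m + 2) → Fin 2 → ℝ := Fin.cons ![1, 1] (Fin.cons ![1, 1] fun _ => ![2, 2])
  let d₁ : Fin (m + 2) → Fin 2 → ℝ := Fin.cons ![2, 1 / 2] (Fin.cons ![2, 1 / 2] fun _ => ![2, 2])
  have e₀ : evalAt 0 hyperbolicPath = Matrix.diagonal ![1, 1] := by
    rw [evalAt_hyperbolicPath]
    ext i j
    fin_cases i <;> fin_cases j <;> simp
  have e₁ : evalAt 1 hyperbolicPath = Matrix.diagonal ![2, 1 / 2] := by
    rw [evalAt_hyperbolicPath]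
    ext i j
    fin_cases i <;> fin_cases j <;> norm_num
  have h₀ : ∀ i, evalAt 0 (A i) = Matrix.diagonal (d₀ i) := fun i =>
    Fin.cases e₀ (fun i => Fin.cases e₀ (fun _ => evalAt_constTwo 0) i) i
  have h₁ : ∀ i, evalAt 1 (A i) = Matrix.diagonal (d₁ i) := fun i =>
    Fin.cases e₁ (fun i => Fin.cases e₁ (fun _ => evalAt_constTwo 1) i) i
  have p₀ : ∀ i k, 0 < d₀ i k := fun i k => by
    refine Fin.cases ?_ (fun i => Fin.cases ?_ (fun i => ?_) i) i <;> fin_cases k <;> simp [d₀]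
  have p₁ : ∀ i k, 0 < d₁ i k := fun i k => by
    refine Fin.cases ?_ (fun i => Fin.cases ?_ (fun i => ?_) i) i <;> fin_cases k <;> simp [d₁]
  have key := hψ.homotopy 2 A hc (fun i => by rw [h₀, Matrix.posDef_diagonal_iff]; exact p₀ i)
    (fun i => by rw [h₁, Matrix.posDef_diagonal_iff]; exact p₁ i)
  rw [hψ.logTuple_diagonal _ _ d₀ h₀, hψ.logTuple_diagonal _ _ d₁ h₁] at key
  simp only [hone fun i => Real.log _, Fin.prod_univ_succ] at key
  simp [d₀, d₁] at key
  -- The endpoint at 0 gives zero since `log 1 = 0`, so `key` amounts to `2 * (log 2) ^ (m + 2) *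
  -- scalarValue ψ 1 = 0`.
  have hlog : Real.log 2 * (Real.log 2 * Real.log 2 ^ m) ≠ 0 := by positivity
  have h0 : scalarValue ψ 1 = 0 := (mul_eq_zero.mp (by linarith)).resolve_left hlog
  rw [hone a, h0, mul_zero]

end Homotopy

/-! ### Simultaneous diagonalisation in finite dimension -/

section FiniteDimensional

variable {l : ℕ}

/-- A proper nonzero eigenspace of one operator is preserved by all those commuting with it. If
there is none, every operator is scalar and any line works. -/
lemma Fibre.exists_invariant {H : Type u} [NormedAddCommGroup H] [InnerProductSpace ℂ H]
    [CompleteSpace H] [FiniteDimensional ℂ H] (A : Fibre l H) (hH : 2 ≤ Module.finrank ℂ H) :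
    ∃ V : Submodule ℂ H, V ≠ ⊥ ∧ V ≠ ⊤ ∧ ∀ i, ∀ x ∈ V, A.op i x ∈ V := by
  have : Nontrivial H := Module.nontrivial_of_finrank_pos (R := ℂ) (by omega)
  by_cases h : ∃ i μ, Module.End.eigenspace (A.op i : Module.End ℂ H) μ ≠ ⊥ ∧
      Module.End.eigenspace (A.op i : Module.End ℂ H) μ ≠ ⊤
  · obtain ⟨i, μ, h1, h2⟩ := h
    refine ⟨_, h1, h2, fun j x hx => ?_⟩
    rw [Module.End.mem_eigenspace_iff] at hx ⊢
    have := DFunLike.congr_fun (A.commute i j).eq x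
    calc A.op i (A.op j x) = A.op j (A.op i x) := this
      _ = A.op j (μ • x) := congrArg _ hx
      _ = μ • A.op j x := map_smul _ _ _
  · push Not at h
    obtain ⟨v, hv⟩ := exists_ne (0 : H)
    refine ⟨Submodule.span ℂ {v}, by simpa using hv, fun e => ?_, fun i x hx => ?_⟩
    · have := finrank_span_singleton (K := ℂ) hv
      rw [e, finrank_top] at this
      omega
    · obtain ⟨μ, hμ⟩ := Module.End.exists_eigenvalue (A.op i : Module.End ℂ H)
      have hx' : x ∈ Module.End.eigenspace (A.op i : Module.End ℂ H) μ := by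
        rw [h i μ hμ]; trivial
      rw [Module.End.mem_eigenspace_iff] at hx'
      have : A.op i x = μ • x := hx'
      rw [this]
      exact Submodule.smul_mem _ _ hx

lemma IsTraceMap.eq_zero_of_finiteDimensional {ψ : X.{u} l → ℝ} (hψ : IsTraceMap ψ) (hl : 2 ≤ l)
    {H : Type u} [NormedAddCommGroup H] [InnerProductSpace ℂ H] [CompleteSpace H]
    [FiniteDimensional ℂ H] (A : Fibre l H) : ψ ⟨A⟩ = 0 := by
  induction hn : Module.finrank ℂ H using Nat.strong_induction_on generalizing H with
  | _ n ih =>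
  subst hn
  obtain h | h | h : Module.finrank ℂ H = 0 ∨ Module.finrank ℂ H = 1 ∨ 2 ≤ Module.finrank ℂ H := by
    omega
  · have := Module.finrank_zero_iff.mp h
    exact hψ.eq_zero_of_op_eq_zero A ⟨0, by omega⟩
      (ContinuousLinearMap.ext fun x => Subsingleton.elim _ _)
  · obtain ⟨v, hv, -⟩ := finrank_eq_one_iff'.mp h
    have ha : ∀ i, ∃ a : ℝ, A.op i v = (a : ℂ) • v := fun i => by
      obtain ⟨c, hc⟩ := (finrank_eq_one_iff_of_nonzero' v hv).mp h (A.op i v)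
      have hsym := ContinuousLinearMap.isSelfAdjoint_iff_isSymmetric.mp (A.isSelfAdjoint i)
      have hv' : Module.End.HasEigenvalue (A.op i : Module.End ℂ H) c :=
        Module.End.hasEigenvalue_of_hasEigenvector
          ⟨Module.End.mem_eigenspace_iff.mpr hc.symm, hv⟩
      refine ⟨c.re, ?_⟩
      rw [Complex.conj_eq_iff_re.mp (hsym.conj_eigenvalue_eq_self hv'), hc]
    choose a ha using ha
    rw [hψ.eq_scalarValue h A hv a ha, hψ.scalarValue_eq_zero hl]
  · obtain ⟨V, h1, h2, hV⟩ := A.exists_invariant h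
    have := FiniteDimensional.complete ℂ V
    obtain ⟨B, C, -, -, e⟩ := hψ.exists_eq_add_of_invariant A V hV
    have h3 := Submodule.finrank_lt h2
    have h4 := V.finrank_add_finrank_orthogonal
    have h5 := (Submodule.one_le_finrank_iff (S := V)).mpr h1
    rw [e, ih _ h3 B rfl, ih _ (by omega) C rfl, add_zero]

end FiniteDimensional

/-! ### Finite-rank truncation in trace norm -/

section Truncation

open Filter Topology

variable {H : Type u} [NormedAddCommGroup H] [InnerProductSpace ℂ H] [CompleteSpace H]

/-- The soft threshold function, which vanishes on `[-ε, ε]` and is within `ε` of the identity. -/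
def softThreshold (ε x : ℝ) : ℝ := x - max (-ε) (min ε x)

lemma continuous_softThreshold (ε : ℝ) : Continuous (softThreshold ε) := by
  unfold softThreshold; fun_prop

lemma abs_softThreshold_le {ε : ℝ} (hε : 0 ≤ ε) (x : ℝ) : |softThreshold ε x| ≤ |x| := by
  unfold softThreshold
  grind

/-- This bound supplies the summable majorant for dominated convergence; the bound by `ε` below
supplies termwise convergence. -/
lemma abs_softThreshold_sub_le {ε : ℝ} (hε : 0 ≤ ε) (x : ℝ) : |softThreshold ε x - x| ≤ |x| := by
  unfold softThreshold
  grind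

lemma abs_softThreshold_sub_le' {ε : ℝ} (hε : 0 ≤ ε) (x : ℝ) : |softThreshold ε x - x| ≤ ε := by
  unfold softThreshold
  grind

/-- The scalar form of `|A| ≥ ε` on the range of the truncation: the threshold function vanishes
wherever `|x| < ε`. -/
lemma softThreshold_mul_nonneg {ε : ℝ} (x : ℝ) :
    0 ≤ softThreshold ε x * (|x| - ε) * softThreshold ε x := by
  by_cases h : ε ≤ |x|
  · have : 0 ≤ |x| - ε := by linarith
    rw [mul_right_comm]
    exact mul_nonneg (mul_self_nonneg _) this
  · have : softThreshold ε x = 0 := by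
      unfold softThreshold
      grind
    simp [this]

lemma re_inner_le_of_le {S T : H →L[ℂ] H} (h : S ≤ T) (x : H) :
    RCLike.re ⟪S x, x⟫_ℂ ≤ RCLike.re ⟪T x, x⟫_ℂ := by
  have := ((ContinuousLinearMap.le_def _ _).mp h).re_inner_nonneg_left x
  simp only [sub_apply, inner_sub_left, map_sub] at this
  linarith

lemma re_inner_nonneg {T : H →L[ℂ] H} (h : 0 ≤ T) (x : H) : 0 ≤ RCLike.re ⟪T x, x⟫_ℂ := by
  simpa using re_inner_le_of_le h x

lemma re_inner_smul_one (c : ℝ) (x : H) :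
    RCLike.re ⟪(c • (1 : H →L[ℂ] H)) x, x⟫_ℂ = c * ‖x‖ ^ 2 := by
  have : (c • (1 : H →L[ℂ] H)) x = (c : ℂ) • x := by simp
  rw [this, inner_smul_left, Complex.conj_ofReal, ← inner_self_eq_norm_sq (𝕜 := ℂ)]
  exact Complex.re_ofReal_mul _ _

lemma traceNorm_mono {S T : H →L[ℂ] H} (h : CFC.abs S ≤ CFC.abs T) : traceNorm S ≤ traceNorm T :=
  ENNReal.tsum_le_tsum fun _ => ENNReal.ofReal_le_ofReal (re_inner_le_of_le h _)

lemma abs_cfc_eq {A : H →L[ℂ] H} (hA : IsSelfAdjoint A) {f : ℝ → ℝ} (hf : Continuous f) :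
    CFC.abs (cfc f A) = cfc (fun x => |f x|) A := by
  rw [CFC.abs_eq_cfc_norm _ (cfc_predicate f A), ← cfc_comp' (fun x => ‖x‖) f A]
  rfl

lemma abs_cfc_le_abs {A : H →L[ℂ] H} (hA : IsSelfAdjoint A) {f : ℝ → ℝ} (hf : Continuous f)
    (h : ∀ x, |f x| ≤ |x|) : CFC.abs (cfc f A) ≤ CFC.abs A := by
  rw [abs_cfc_eq hA hf, CFC.abs_eq_cfc_norm A hA]
  exact cfc_mono (fun x _ => h x) (by fun_prop) (by fun_prop)

lemma IsTraceClass.cfc_softThreshold {A : H →L[ℂ] H} (hA : IsSelfAdjoint A) (ht : IsTraceClass A)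
    {ε : ℝ} (hε : 0 ≤ ε) : IsTraceClass (cfc (softThreshold ε) A) :=
  (traceNorm_mono (abs_cfc_le_abs hA (continuous_softThreshold ε)
    (abs_softThreshold_le hε))).trans_lt ht

lemma cfc_softThreshold_sub {A : H →L[ℂ] H} (hA : IsSelfAdjoint A) (ε : ℝ) :
    cfc (softThreshold ε) A - A = cfc (fun x => softThreshold ε x - x) A := by
  have := (continuous_softThreshold ε).continuousOn (s := spectrum ℝ A)
  rw [cfc_sub _ _ A, cfc_id' ℝ A]

/-- The truncations of a self-adjoint operator of trace class converge to it in trace norm. -/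
lemma tendsto_traceNorm_cfc_softThreshold_sub {A : H →L[ℂ] H} (hA : IsSelfAdjoint A)
    (ht : IsTraceClass A) : Tendsto (fun ε => traceNorm (cfc (softThreshold ε) A - A)) (𝓝[>] 0)
      (𝓝 0) := by
  obtain ⟨w, b, -⟩ := exists_hilbertBasis ℂ H
  let r := fun i => RCLike.re ⟪CFC.abs A (b i), b i⟫_ℂ
  let t := fun (ε : ℝ) i => RCLike.re ⟪CFC.abs (cfc (softThreshold ε) A - A) (b i), b i⟫_ℂ
  have hcont : ∀ ε, Continuous fun x => softThreshold ε x - x := fun ε =>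
    (continuous_softThreshold ε).sub continuous_id
  have hr : Summable r := by
    rw [IsTraceClass, traceNorm_eq b, traceIn] at ht
    have := ENNReal.summable_toReal ht.ne
    refine this.congr fun i => ?_
    exact ENNReal.toReal_ofReal (re_inner_nonneg (CFC.abs_nonneg A) (b i))
  have ht0 : ∀ ε i, 0 ≤ t ε i := fun ε i =>
    re_inner_nonneg (CFC.abs_nonneg (cfc (softThreshold ε) A - A)) (b i)
  have htr : ∀ ε, 0 < ε → ∀ i, t ε i ≤ r i := fun ε hε i => by
    have h1 : CFC.abs (cfc (softThreshold ε) A - A) ≤ CFC.abs A := by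
      rw [cfc_softThreshold_sub hA]
      exact abs_cfc_le_abs hA (hcont ε) (abs_softThreshold_sub_le hε.le)
    exact re_inner_le_of_le h1 (b i)
  have hte : ∀ ε, 0 < ε → ∀ i, t ε i ≤ ε := fun ε hε i => by
    have h1 : CFC.abs (cfc (softThreshold ε) A - A) ≤ algebraMap ℝ _ ε := by
      rw [cfc_softThreshold_sub hA, abs_cfc_eq hA (hcont ε), ← cfc_const ε A]
      exact cfc_mono (fun x _ => abs_softThreshold_sub_le' hε.le x) (hcont ε).abs.continuousOn
        (by fun_prop)
    refine (re_inner_le_of_le h1 (b i)).trans_eq ?_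
    rw [Algebra.algebraMap_eq_smul_one, re_inner_smul_one, b.orthonormal.1 i, one_pow, mul_one]
  have key : Tendsto (fun ε => ∑' i, t ε i) (𝓝[>] 0) (𝓝 (∑' _ : w, (0 : ℝ))) := by
    refine tendsto_tsum_of_dominated_convergence hr (fun i => ?_) ?_
    · refine tendsto_of_tendsto_of_tendsto_of_le_of_le' tendsto_const_nhds
        (tendsto_nhdsWithin_of_tendsto_nhds tendsto_id) (Eventually.of_forall fun ε => ht0 ε i) ?_
      filter_upwards [self_mem_nhdsWithin] with ε hε using hte ε hε i
    · filter_upwards [self_mem_nhdsWithin] with ε hε i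
      rw [Real.norm_of_nonneg (ht0 ε i)]
      exact htr ε hε i
  rw [tsum_zero] at key
  have key' := ENNReal.tendsto_ofReal key
  rw [ENNReal.ofReal_zero] at key'
  refine key'.congr' ?_
  filter_upwards [self_mem_nhdsWithin] with ε hε
  rw [traceNorm_eq b]
  exact ENNReal.ofReal_tsum_of_nonneg (ht0 ε) (hr.of_nonneg_of_le (ht0 ε) (htr ε hε))

/-- Extend a maximal orthonormal set of `R` to a Hilbert basis of `H`. Each of its vectors
contributes at least `ε` to the finite trace of `|A|`, so the set is finite. -/
lemma finiteDimensional_of_le_inner {A : H →L[ℂ] H} (ht : IsTraceClass A) {ε : ℝ} (hε : 0 < ε)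
    (R : Submodule ℂ H) (hR : ∀ x ∈ R, ε * ‖x‖ ^ 2 ≤ RCLike.re ⟪CFC.abs A x, x⟫_ℂ) :
    FiniteDimensional ℂ R := by
  obtain ⟨w, -, hw, hmax⟩ := exists_maximal_orthonormal (orthonormal_empty ℂ R)
  have ho : Orthonormal ℂ fun x : w => ((x : R) : H) := hw.comp_linearIsometry R.subtypeₗᵢ
  obtain ⟨w', b, hsub, hb⟩ := ho.toSubtypeRange.exists_hilbertBasis_extension
  rw [IsTraceClass, traceNorm_eq b, traceIn] at ht
  have hfin := ENNReal.finite_const_le_of_tsum_ne_top ht.ne (ENNReal.ofReal_pos.mpr hε).ne'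
  have hw' : w.Finite := by
    let g : w → w' := fun x => ⟨((x : R) : H), hsub ⟨x, rfl⟩⟩
    have hg : Function.Injective g := fun x y h => by
      have : ((x : R) : H) = (y : R) := congrArg (Subtype.val : w' → H) h
      exact Subtype.ext (Subtype.ext this)
    have : Finite w := by
      refine Set.finite_univ_iff.mp ((hfin.preimage hg.injOn).subset fun x _ => ?_)
      refine ENNReal.ofReal_le_ofReal ?_
      have h1 := hR _ (x : R).2
      have h2 : ‖((x : R) : H)‖ = 1 := ho.1 x
      rw [h2] at h1
      rw [hb]
      simpa using h1
    exact Set.toFinite w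
  have : FiniteDimensional ℂ (Submodule.span ℂ w) := FiniteDimensional.span_of_finite ℂ hw'
  -- By maximality the span has zero orthogonal complement in `R`; being finite-dimensional, it is
  -- then all of `R`, whether or not `R` is closed in `H`.
  have hbot := (maximal_orthonormal_iff_orthogonalComplement_eq_bot hw).mp hmax
  rw [Submodule.orthogonal_eq_bot_iff] at hbot
  rw [hbot] at this
  exact Module.Finite.equiv (Submodule.topEquiv (R := ℂ) (M := R))

/-- The truncations of a self-adjoint operator of trace class have finite rank. -/
lemma finiteDimensional_range_cfc_softThreshold {A : H →L[ℂ] H} (hA : IsSelfAdjoint A)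
    (ht : IsTraceClass A) {ε : ℝ} (hε : 0 < ε) :
    FiniteDimensional ℂ (cfc (softThreshold ε) A).range := by
  refine finiteDimensional_of_le_inner ht hε _ ?_
  rintro _ ⟨y, rfl⟩
  have hg := continuous_softThreshold ε
  set T := cfc (softThreshold ε) A
  have hsym := ContinuousLinearMap.isSelfAdjoint_iff_isSymmetric.mp
    (cfc_predicate (softThreshold ε) A : IsSelfAdjoint T)
  -- Positivity of `T (|A| - ε) T` at `y` is the required inequality at `T y`, since `T` is
  -- symmetric.
  have h1 : T * (CFC.abs A - algebraMap ℝ _ ε) * T =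
      cfc (fun x => softThreshold ε x * (|x| - ε) * softThreshold ε x) A := by
    have c1 : ContinuousOn (softThreshold ε) (spectrum ℝ A) := hg.continuousOn
    have c2 : ContinuousOn (fun x : ℝ => |x|) (spectrum ℝ A) := by fun_prop
    rw [cfc_mul _ _ A, cfc_mul _ _ A, cfc_sub _ _ A, cfc_const ε A, CFC.abs_eq_cfc_norm A hA]
    rfl
  have h2 : 0 ≤ T * (CFC.abs A - algebraMap ℝ _ ε) * T := by
    rw [h1]
    exact cfc_nonneg fun x _ => softThreshold_mul_nonneg x
  have h3 := re_inner_nonneg h2 y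
  have h4 : ⟪(T * (CFC.abs A - algebraMap ℝ _ ε) * T) y, y⟫_ℂ =
      ⟪(CFC.abs A - algebraMap ℝ (H →L[ℂ] H) ε) (T y), T y⟫_ℂ := hsym _ _
  rw [h4] at h3
  simp only [sub_apply, inner_sub_left, map_sub, Algebra.algebraMap_eq_smul_one] at h3
  rw [re_inner_smul_one] at h3
  change ε * ‖T y‖ ^ 2 ≤ RCLike.re ⟪CFC.abs A (T y), T y⟫_ℂ
  linarith

end Truncation

/-! ### From finite rank to trace class -/

section Main

open Filter Topology

variable {l : ℕ} {H : Type u} [NormedAddCommGroup H] [InnerProductSpace ℂ H] [CompleteSpace H]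

/-- The truncation of a tuple, of finite rank for `0 < ε`. -/
def Fibre.truncate (A : Fibre l H) {ε : ℝ} (hε : 0 ≤ ε) : Fibre l H where
  op i := cfc (softThreshold ε) (A.op i)
  isSelfAdjoint _ := cfc_predicate _ _
  isTraceClass i := (A.isTraceClass i).cfc_softThreshold (A.isSelfAdjoint i) hε
  commute i j := (((A.commute i j).cfc_real _).symm.cfc_real _).symm

/-- The sum of the ranges is finite-dimensional and invariant. By symmetry its orthogonal complement
lies in every kernel, so the complementary summand has a zero entry. -/
lemma IsTraceMap.eq_zero_of_finite_rank {ψ : X.{u} l → ℝ} (hψ : IsTraceMap ψ) (hl : 2 ≤ l)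
    (A : Fibre l H) (hA : ∀ i, FiniteDimensional ℂ (A.op i).range) : ψ ⟨A⟩ = 0 := by
  let V : Submodule ℂ H := ⨆ i, (A.op i).range
  have hfin : FiniteDimensional ℂ V := Submodule.finiteDimensional_iSup _
  have := FiniteDimensional.complete ℂ V
  have hmem : ∀ i x, A.op i x ∈ V := fun i x =>
    Submodule.mem_iSup_of_mem i ⟨x, rfl⟩
  obtain ⟨B, C, -, hC, e⟩ := hψ.exists_eq_add_of_invariant A V fun i x _ => hmem i x
  have hC0 : C.op ⟨0, by omega⟩ = 0 := by
    ext x : 1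
    have hx : A.op ⟨0, by omega⟩ x = 0 := by
      have hsym := ContinuousLinearMap.isSelfAdjoint_iff_isSymmetric.mp
        (A.isSelfAdjoint ⟨0, by omega⟩)
      rw [← inner_self_eq_zero (𝕜 := ℂ)]
      exact (hsym _ _).symm.trans ((Submodule.mem_orthogonal _ _).mp x.2 _ (hmem _ _))
    exact Subtype.ext ((hC _ x).trans hx)
  rw [e, hψ.eq_zero_of_finiteDimensional hl B, hψ.eq_zero_of_op_eq_zero C _ hC0, add_zero]

lemma IsTraceMap.fibre_eq_zero {ψ : X.{u} l → ℝ} (hψ : IsTraceMap ψ) (hl : 2 ≤ l)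
    (A : Fibre l H) : ψ ⟨A⟩ = 0 := by
  by_contra hne
  -- With tolerance `|ψ ⟨A⟩|` itself, a nearby tuple of value zero is already a contradiction.
  obtain ⟨δ, hδ, h⟩ := hψ.continuous H A |ψ ⟨A⟩| (abs_pos.mpr hne)
  have hev : ∀ᶠ ε in 𝓝[>] (0 : ℝ), ∀ i,
      traceNorm (cfc (softThreshold ε) (A.op i) - A.op i) < ENNReal.ofReal δ :=
    eventually_all.mpr fun i => (tendsto_traceNorm_cfc_softThreshold_sub (A.isSelfAdjoint i)
      (A.isTraceClass i)).eventually_lt_const (ENNReal.ofReal_pos.mpr hδ)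
  obtain ⟨ε, hε', hε⟩ := (hev.and self_mem_nhdsWithin).exists
  have hε : 0 < ε := hε
  have h1 := h (A.truncate hε.le) hε'
  rw [hψ.eq_zero_of_finite_rank hl (A.truncate hε.le) fun i =>
    finiteDimensional_range_cfc_softThreshold (A.isSelfAdjoint i) (A.isTraceClass i) hε,
    zero_sub, abs_neg] at h1
  exact lt_irrefl _ h1

end Main

end CommutingTrace

end

theorem mainTheorem1 (l : ℕ) (hl : 2 ≤ l) (ψ : CommutingTrace.X.{u} l → ℝ)
    (hψ : CommutingTrace.IsTraceMap ψ) : ∀ x : CommutingTrace.X.{u} l, ψ x = 0 :=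
  fun x => hψ.fibre_eq_zero hl x.tuple
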